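/- **Setting.** Let $\Omega$ be a set with a function $\rho:\Omega\times\Omega\to[0,\infty)$ such that $\rho(x,y)=0\iff x=y$ and $\rho(x,y)=\rho(y,x)$; put $B(x,r)=\{y:\rho(x,y)<r\}$ and give $\Omega$ the topology in which $U$ is open iff every $x\in U$ has a ball $B(x,r)\subset U$, $r>0$. Assume that balls are open and that $\overline{B(x,r)}\subset\{y:\rho(x,y)\le r\}$. Let $\mu$ be a positive regular Borel measure on $\Omega$, and let $\Omega_1\subset\Omega_2\subset\cdots$ be bounded measurable sets with union $\Omega$ and compact closures such that for every $n$ there are $\varepsilon_n>0$, $B_n\ge1$, $C_n>1$ with $$\{x:\rho(x,y)<2\varepsilon_n\text{ for some }y\in\Omega_n\}\subset\Omega_{n+1},\qquad \rho(x,y)\le B_n(\rho(x,z)+\rho(z,y))\quad(x,y,z\in\Omega_n),$$ $$0<\mu(B(x,2r))\le C_n\,\mu(B(x,r))<\infty\qquad(x\in\Omega_n,\ 0<r\le\varepsilon_n).$$ (Such $(\Omega,\{\Omega_n\},\rho,\mu)$ is called a locally homogeneous space.) A constant *depends only on $n$* if it depends only on the numbers $\varepsilon_i,B_i,C_i$ for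 $i=n,\dots,n+3$. For $E\subset\Omega$ let $$\|u\|_{C^\eta(E)}=\sup_E|u|+\sup_{x\ne y\in E}\frac{|u(x)-u(y)|}{\rho(x,y)^\eta}.$$ **Theorem ($C^\eta$ estimate for fractional integrals).** There are constants $\kappa>1$ and $H>1$ depending only on $n$ with the following property. Let $\overline x\in\Omega_n$, $R_0<2\varepsilon_n$, $R>0$ with $\kappa R\le R_0$. Let $K(x,y)$ be a measurable real function defined for $x,y\in B(\overline x,R_0)$, $x\ne y$, that satisfies, for some $\nu\in(0,1)$, $\beta>0$, $A,B>0$, $M>1$ with $M\ge 2B_{n+1}$, $$|K(x,y)|\le\frac{A\,\rho(x,y)^\nu}{\mu(B(x,\rho(x,y)))}\qquad(x,y\in B(\overline x,R_0),\ x\ne y),$$ $$|K(x_0,y)-K(x,y)|+|K(y,x_0)-K(y,x)|\le\frac{B\,\rho(x_0,y)^\nu}{\mu(B(x_0,\rho(x_0,y)))}\left(\frac{\rho(x_0,x)}{\rho(x_0,y)}\right)^{\beta}$$ for $x_0,x,y\in B(\overline x,R_0)$ with $\rho(x_0,y)>M\rho(x_0,x)$. Let $\alpha,L>0$, $c_1,\dots,c_4\in(0,1)$,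 and let $a,b$ be cutoff functions on $\Omega_{n+1}$: $0\le a,b\le1$; $a=1$ on $B(\overline x,c_1R)$, $a=0$ off $B(\overline x,c_2R)$; $b=1$ on $B(\overline x,c_3R)$, $b=0$ off $B(\overline x,c_4R)$; and $|\phi(x_1)-\phi(x_2)|\le L(\rho(x_1,x_2)/R)^\alpha$ for $x_1,x_2\in\Omega_{n+1}$ and $\phi\in\{a,b\}$. Put $\widetilde K(x,y)=a(x)K(x,y)b(y)$ and $$I_\nu f(x)=\int_{B(\overline x,R)\setminus\{x\}}\widetilde K(x,y)f(y)\,d\mu(y).$$ Then for every $\eta$ with $0<\eta<\min(\alpha,\beta,\nu)$ and every $f\in C^\eta(B(\overline x,HR))$ the integral $I_\nu f(x)$ converges absolutely for every $x\in B(\overline x,R)$, and $$\|I_\nu f\|_{C^\eta(B(\overline x,R))}\le c\,\|f\|_{C^\eta(B(\overline x,HR))},$$ where $c$ depends only on $\eta$, $n$, $R$, on the constants $\nu,\beta,A,B,M$ of $K$, and on the constants $\alpha,L,c_1,\dots,c_4$ of the cutoff functions. -/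

import Mathlib

open MeasureTheory
open scoped ENNReal

noncomputable section

/-- The ball `B(x, r) = {y : ρ(x, y) < r}`. -/
def rhoBall {Ω : Type*} (ρ : Ω → Ω → ℝ) (x : Ω) (r : ℝ) : Set Ω :=
  {y | ρ x y < r}

/-- A locally homogeneous space `(Ω, {Ω_n}, ρ, μ)`. The exhaustion is indexed by all natural
numbers `0, 1, 2, …` (a mere relabelling of `1, 2, 3, …`). The three sequences `eps`, `quasi`,
`dbl` are the constants `ε_n`, `B_n`, `C_n`. -/
structure LocallyHomogeneousSpace (Ω : Type*) [TopologicalSpace Ω] [MeasurableSpace Ω]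
    (μ : Measure Ω) where
  ρ : Ω → Ω → ℝ
  rho_nonneg : ∀ x y, 0 ≤ ρ x y
  rho_eq_zero : ∀ x y, ρ x y = 0 ↔ x = y
  rho_symm : ∀ x y, ρ x y = ρ y x
  /-- The topology of `Ω` is the one defined by the balls. -/
  isOpen_iff : ∀ U : Set Ω, IsOpen U ↔ ∀ x ∈ U, ∃ r > 0, rhoBall ρ x r ⊆ U
  isOpen_ball : ∀ x r, 0 < r → IsOpen (rhoBall ρ x r)
  closure_ball : ∀ x r, 0 < r → closure (rhoBall ρ x r) ⊆ {y | ρ x y ≤ r}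
  borel : BorelSpace Ω
  regular : μ.Regular
  /-- The increasing sequence `Ω_n`. -/
  exh : ℕ → Set Ω
  exh_mono : Monotone exh
  exh_bounded : ∀ n, ∃ x r, 0 < r ∧ exh n ⊆ rhoBall ρ x r
  exh_measurable : ∀ n, MeasurableSet (exh n)
  exh_iUnion : ⋃ n, exh n = Set.univ
  exh_compact : ∀ n, IsCompact (closure (exh n))
  eps : ℕ → ℝ
  eps_pos : ∀ n, 0 < eps n
  exh_succ : ∀ n, {x | ∃ y ∈ exh n, ρ x y < 2 * eps n} ⊆ exh (n + 1)
  quasi : ℕ → ℝ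
  one_le_quasi : ∀ n, 1 ≤ quasi n
  quasi_triangle : ∀ n, ∀ x ∈ exh n, ∀ y ∈ exh n, ∀ z ∈ exh n,
    ρ x y ≤ quasi n * (ρ x z + ρ z y)
  dbl : ℕ → ℝ
  one_lt_dbl : ∀ n, 1 < dbl n
  doubling : ∀ n, ∀ x ∈ exh n, ∀ r, 0 < r → r ≤ eps n →
    0 < μ (rhoBall ρ x (2 * r)) ∧
    μ (rhoBall ρ x (2 * r)) ≤ ENNReal.ofReal (dbl n) * μ (rhoBall ρ x r) ∧
    μ (rhoBall ρ x r) < ∞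

/-- The Hölder norm `‖u‖_{C^η(E)} = sup_E |u| + sup_{x ≠ y ∈ E} |u(x) - u(y)| / ρ(x, y)^η`,
with values in `[0, ∞]`; `u` belongs to `C^η(E)` when it is finite. -/
def holderNorm {Ω : Type*} (ρ : Ω → Ω → ℝ) (η : ℝ) (E : Set Ω) (u : Ω → ℝ) : ℝ≥0∞ :=
  (⨆ x ∈ E, ENNReal.ofReal |u x|) +
    ⨆ x ∈ E, ⨆ y ∈ E, ⨆ _ : x ≠ y, ENNReal.ofReal (|u x - u y| / ρ x y ^ η)

/-- The function `φ` on `U` is a cutoff function of class `C^α`, equal to `1` on the ball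
`B(x₀, s R)` and to `0` off the ball `B(x₀, t R)`, with
`|φ(x₁) - φ(x₂)| ≤ L (ρ(x₁, x₂) / R)^α` on `U`. -/
structure IsHolderCutoff {Ω : Type*} (ρ : Ω → Ω → ℝ) (U : Set Ω) (α L : ℝ)
    (x₀ : Ω) (s t R : ℝ) (φ : Ω → ℝ) : Prop where
  mem_Icc : ∀ x ∈ U, 0 ≤ φ x ∧ φ x ≤ 1
  eq_one : ∀ x ∈ U, x ∈ rhoBall ρ x₀ (s * R) → φ x = 1
  eq_zero : ∀ x ∈ U, x ∉ rhoBall ρ x₀ (t * R) → φ x = 0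
  holder : ∀ x₁ ∈ U, ∀ x₂ ∈ U, |φ x₁ - φ x₂| ≤ L * (ρ x₁ x₂ / R) ^ α

/-- The standard estimates of order `ν` for a kernel `K` on `E × E` off the diagonal. -/
structure StandardEstimates {Ω : Type*} [MeasurableSpace Ω] (ρ : Ω → Ω → ℝ) (μ : Measure Ω)
    (E : Set Ω) (ν β A B M : ℝ) (K : Ω → Ω → ℝ) : Prop where
  size : ∀ x ∈ E, ∀ y ∈ E, x ≠ y →
    |K x y| ≤ A * ρ x y ^ ν / μ.real (rhoBall ρ x (ρ x y))
  smooth : ∀ x₀ ∈ E, ∀ x ∈ E, ∀ y ∈ E, ρ x₀ y > M * ρ x₀ x →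
    |K x₀ y - K x y| + |K y x₀ - K y x| ≤
      B * ρ x₀ y ^ ν / μ.real (rhoBall ρ x₀ (ρ x₀ y)) * (ρ x₀ x / ρ x₀ y) ^ β

/-- The kernel `K̃(x, y) = a(x) K(x, y) b(y)`. -/
def cutoffKernel {Ω : Type*} (a : Ω → ℝ) (K : Ω → Ω → ℝ) (b : Ω → ℝ) (x y : Ω) : ℝ :=
  a x * K x y * b y

/-- The fractional integral `∫_D k(x, y) f(y) dμ(y)`. Since the kernel is defined off the diagonal
only, the point `y = x` is left out (this matters only if `x` is an atom of `μ`). -/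
def fracIntegral {Ω : Type*} [MeasurableSpace Ω] (μ : Measure Ω) (D : Set Ω)
    (k : Ω → Ω → ℝ) (f : Ω → ℝ) (x : Ω) : ℝ :=
  ∫ y in D \ {x}, k x y * f y ∂μ

end

/-! ### Balls, their measures, and the dyadic integral bound. -/

namespace LocallyHomogeneousSpace

variable {Ω : Type*} [TopologicalSpace Ω] [MeasurableSpace Ω] {μ : Measure Ω}

/-! No cancellation is needed: since `η < ν`, everything follows from absolute bounds. Write `w_x(y)
= ρ(x,y)^(ν-η) / μ(B(x,ρ(x,y)))`. Splitting into dyadic annuli and using doubling, the integral of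
`w_x` over the ball is bounded uniformly in `x` (`lintegral_fractional_le`).

The kernel is at most a constant times `w_x`, and the integrands at `x₁` and `x₂` differ by at most
a constant times `sup |f| · ρ(x₁,x₂)^η · (w_{x₁} + w_{x₂})`
(`KernelSetting.abs_fracIntegrand_sub_le`). Near `x₁` the size estimate spends `η` powers of the
distance; far from it, kernel smoothness and the Hölder bound on `a` supply the factor. Integrating
gives both parts of the norm. The Hölder continuity of `f` enters only through measurability. -/

lemma rho_self (S : LocallyHomogeneousSpace Ω μ) (x : Ω) : S.ρ x x = 0 :=
  (S.rho_eq_zero x x).2 rfl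

lemma rho_pos (S : LocallyHomogeneousSpace Ω μ) {x y : Ω} (h : x ≠ y) : 0 < S.ρ x y :=
  lt_of_le_of_ne (S.rho_nonneg x y) fun h0 => h ((S.rho_eq_zero x y).1 h0.symm)

lemma tendsto_rho (S : LocallyHomogeneousSpace Ω μ) (x : Ω) :
    Filter.Tendsto (S.ρ x) (nhds x) (nhds 0) := by
  rw [Metric.tendsto_nhds]
  intro r hr
  have hx : x ∈ rhoBall S.ρ x r := by
    change S.ρ x x < r
    rwa [S.rho_self]
  filter_upwards [(S.isOpen_ball x r hr).mem_nhds hx] with y hy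
  rw [Real.dist_eq, sub_zero, abs_of_nonneg (S.rho_nonneg x y)]
  exact hy

lemma continuousOn_of_holder (S : LocallyHomogeneousSpace Ω μ) {D : Set Ω} {u : Ω → ℝ} {C t : ℝ}
    (ht : 0 < t) (h : ∀ x ∈ D, ∀ y ∈ D, |u x - u y| ≤ C * S.ρ x y ^ t) : ContinuousOn u D := by
  intro x hx
  have h1 : Filter.Tendsto (fun y => C * S.ρ x y ^ t) (nhdsWithin x D) (nhds 0) := by
    have := ((S.tendsto_rho x).rpow_const (Or.inr ht.le)).const_mul C
    rw [Real.zero_rpow ht.ne', mul_zero] at this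
    exact this.mono_left nhdsWithin_le_nhds
  rw [ContinuousWithinAt, tendsto_iff_dist_tendsto_zero]
  refine squeeze_zero' (Filter.Eventually.of_forall fun _ => dist_nonneg) ?_ h1
  filter_upwards [self_mem_nhdsWithin] with y hy
  rw [dist_comm, Real.dist_eq]
  exact h x hx y hy

lemma isClosed_singleton (S : LocallyHomogeneousSpace Ω μ) (x : Ω) : IsClosed ({x} : Set Ω) := by
  rw [← isOpen_compl_iff, S.isOpen_iff]
  intro y hy
  refine ⟨S.ρ y x, S.rho_pos hy, fun z hz hzx => ?_⟩
  rw [Set.mem_singleton_iff.1 hzx] at hz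
  exact lt_irrefl (S.ρ y x) hz

lemma rhoBall_subset_exh (S : LocallyHomogeneousSpace Ω μ) {n : ℕ} {x : Ω} (hx : x ∈ S.exh n)
    {r : ℝ} (hr : r ≤ 2 * S.eps n) : rhoBall S.ρ x r ⊆ S.exh (n + 1) := by
  intro y hy
  refine S.exh_succ n ⟨x, hx, ?_⟩
  rw [S.rho_symm]
  exact lt_of_lt_of_le hy hr

lemma measure_rhoBall_lt_top (S : LocallyHomogeneousSpace Ω μ) {m : ℕ} {x : Ω} (hx : x ∈ S.exh m)
    {r : ℝ} (hr : r ≤ 2 * S.eps m) : μ (rhoBall S.ρ x r) < ∞ := by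
  obtain ⟨-, h2, h3⟩ := S.doubling m x hx _ (S.eps_pos m) le_rfl
  have h : rhoBall S.ρ x r ⊆ rhoBall S.ρ x (2 * S.eps m) := fun y hy => lt_of_lt_of_le hy hr
  exact ((measure_mono h).trans h2).trans_lt (ENNReal.mul_lt_top ENNReal.ofReal_lt_top h3)

/-- A dyadic decomposition bounds the integral of `ρ(x, y)^s / μ(B(x, ρ(x, y)))` by a multiple of
`r^s`. -/
lemma lintegral_fractional_le (S : LocallyHomogeneousSpace Ω μ) {m : ℕ} {x : Ω}
    (hx : x ∈ S.exh m) {r s : ℝ} (hr0 : 0 < r) (hr : r ≤ 2 * S.eps m) (hs : 0 < s) :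
    ∫⁻ y in rhoBall S.ρ x r \ {x},
        ENNReal.ofReal (S.ρ x y ^ s / μ.real (rhoBall S.ρ x (S.ρ x y))) ∂μ ≤
      ENNReal.ofReal (S.dbl m * r ^ s * (1 - (1 / 2 : ℝ) ^ s)⁻¹) := by
  set T : ℕ → ℝ := fun k => (1 / 2 : ℝ) ^ k * r with hT
  have hT0 : ∀ k, 0 < T k := fun k => by positivity
  have hTs : ∀ k, T k = 2 * T (k + 1) := fun k => by simp only [hT, pow_succ]; ring
  have hTr : ∀ k, T k ≤ r := fun k =>
    mul_le_of_le_one_left hr0.le (pow_le_one₀ (by norm_num) (by norm_num))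
  -- The doubling radius is always `T (k + 1)` or smaller, so `r` may be as large as `2 * eps m`.
  have hTe : ∀ k, T (k + 1) ≤ S.eps m := fun k => by
    have := hTs k
    have := hTr k
    linarith
  set g : Ω → ℝ≥0∞ := fun y =>
    ENNReal.ofReal (S.ρ x y ^ s / μ.real (rhoBall S.ρ x (S.ρ x y))) with hg
  set An : ℕ → Set Ω := fun k => {y | T (k + 1) ≤ S.ρ x y ∧ S.ρ x y < T k} with hAn
  have hd : 0 < S.dbl m := one_pos.trans (S.one_lt_dbl m)
  have hcover : rhoBall S.ρ x r \ {x} ⊆ ⋃ k, An k := by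
    rintro y ⟨hy, hyx⟩
    have hpos : 0 < S.ρ x y := S.rho_pos fun h => hyx h.symm
    have hex : ∃ k, T (k + 1) ≤ S.ρ x y := by
      obtain ⟨k, hk⟩ := exists_pow_lt_of_lt_one (div_pos hpos hr0) (by norm_num : (1 / 2 : ℝ) < 1)
      have h1 := hT0 (k + 1)
      have h2 := hTs k
      have h3 : T k < S.ρ x y := (lt_div_iff₀ hr0).1 hk
      exact ⟨k, by linarith⟩
    classical
    refine Set.mem_iUnion.2 ⟨Nat.find hex, Nat.find_spec hex, ?_⟩
    rcases hk : Nat.find hex with _ | k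
    · simpa [hT] using (show S.ρ x y < r from hy)
    · exact not_le.1 (Nat.find_min hex (by omega))
  have hpiece : ∀ k, ∫⁻ y in An k, g y ∂μ ≤
      ENNReal.ofReal (S.dbl m * r ^ s * ((1 / 2 : ℝ) ^ s) ^ k) := by
    intro k
    have hfin : ∀ t ≤ r, μ (rhoBall S.ρ x t) ≠ ∞ := fun t ht =>
      (S.measure_rhoBall_lt_top hx (ht.trans hr)).ne
    -- Doubling asserts positivity for the doubled ball, hence the passage to radius `T (k + 2)`.
    have hp : 0 < μ.real (rhoBall S.ρ x (T (k + 1))) := by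
      refine ENNReal.toReal_pos ?_ (hfin _ (hTr _))
      rw [hTs (k + 1)]
      exact (S.doubling m x hx _ (hT0 _) (hTe _)).1.ne'
    have hdb : μ (rhoBall S.ρ x (T k)) ≤
        ENNReal.ofReal (S.dbl m * μ.real (rhoBall S.ρ x (T (k + 1)))) := by
      rw [ENNReal.ofReal_mul hd.le, Measure.real, ENNReal.ofReal_toReal (hfin _ (hTr _)), hTs k]
      exact (S.doubling m x hx _ (hT0 _) (hTe _)).2.1
    -- On an annulus the inner ball bounds the denominator from below and the outer ball bounds the
    -- domain; doubling cancels their measures.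
    calc ∫⁻ y in An k, g y ∂μ
        ≤ ∫⁻ _ in An k,
            ENNReal.ofReal (T k ^ s / μ.real (rhoBall S.ρ x (T (k + 1)))) ∂μ := by
          refine setLIntegral_mono measurable_const fun y hy => ENNReal.ofReal_le_ofReal ?_
          refine div_le_div₀ (Real.rpow_nonneg (hT0 _).le _)
            (Real.rpow_le_rpow (S.rho_nonneg _ _) hy.2.le hs.le) hp ?_
          exact ENNReal.toReal_mono (hfin _ (hy.2.le.trans (hTr k)))
            (measure_mono fun z hz => lt_of_lt_of_le hz hy.1)
      _ ≤ ENNReal.ofReal (T k ^ s / μ.real (rhoBall S.ρ x (T (k + 1)))) *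
            ENNReal.ofReal (S.dbl m * μ.real (rhoBall S.ρ x (T (k + 1)))) := by
          rw [setLIntegral_const]
          gcongr
          exact (measure_mono fun y hy => hy.2).trans hdb
      _ = ENNReal.ofReal (S.dbl m * r ^ s * ((1 / 2 : ℝ) ^ s) ^ k) := by
          rw [← ENNReal.ofReal_mul (div_nonneg (Real.rpow_nonneg (hT0 _).le _) hp.le)]
          congr 1
          have : T k ^ s = ((1 / 2 : ℝ) ^ s) ^ k * r ^ s := by
            rw [hT, Real.mul_rpow (by positivity) hr0.le, ← Real.rpow_natCast,
              ← Real.rpow_natCast, ← Real.rpow_mul (by norm_num), ← Real.rpow_mul (by norm_num),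
              mul_comm s]
          rw [this]
          field_simp
  have hq0 : 0 ≤ (1 / 2 : ℝ) ^ s := by positivity
  have hq1 : (1 / 2 : ℝ) ^ s < 1 := Real.rpow_lt_one (by norm_num) (by norm_num) hs
  have hsum := (hasSum_geometric_of_lt_one hq0 hq1).mul_left (S.dbl m * r ^ s)
  calc ∫⁻ y in rhoBall S.ρ x r \ {x}, g y ∂μ
      ≤ ∫⁻ y in ⋃ k, An k, g y ∂μ := lintegral_mono_set hcover
    _ ≤ ∑' k, ∫⁻ y in An k, g y ∂μ := lintegral_iUnion_le _ _
    _ ≤ ∑' k, ENNReal.ofReal (S.dbl m * r ^ s * ((1 / 2 : ℝ) ^ s) ^ k) :=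
        ENNReal.tsum_le_tsum hpiece
    _ = _ := by
        rw [← ENNReal.ofReal_tsum_of_nonneg (fun k => by positivity) hsum.summable, hsum.tsum_eq]

end LocallyHomogeneousSpace

/-! ### The Hölder norm as a pair of pointwise bounds. -/

section HolderNorm

variable {Ω : Type*} {ρ : Ω → Ω → ℝ} {η : ℝ} {E : Set Ω} {u : Ω → ℝ}

lemma abs_le_toReal_holderNorm (h : holderNorm ρ η E u < ∞) {x : Ω} (hx : x ∈ E) :
    |u x| ≤ (holderNorm ρ η E u).toReal := by
  rw [← ENNReal.ofReal_le_iff_le_toReal h.ne]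
  exact (le_iSup₂ (f := fun x (_ : x ∈ E) => ENNReal.ofReal |u x|) x hx).trans le_self_add

lemma abs_sub_le_toReal_holderNorm (h : holderNorm ρ η E u < ∞) {x y : Ω} (hx : x ∈ E)
    (hy : y ∈ E) (hρ : 0 ≤ ρ x y) (hxy : x ≠ y → 0 < ρ x y) :
    |u x - u y| ≤ (holderNorm ρ η E u).toReal * ρ x y ^ η := by
  rcases eq_or_ne x y with rfl | hne
  · rw [sub_self, abs_zero]
    exact mul_nonneg ENNReal.toReal_nonneg (Real.rpow_nonneg hρ _)
  rw [← div_le_iff₀ (Real.rpow_pos_of_pos (hxy hne) _), ← ENNReal.ofReal_le_iff_le_toReal h.ne]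
  refine le_trans ?_ le_add_self
  exact (((le_iSup (fun _ : x ≠ y => ENNReal.ofReal (|u x - u y| / ρ x y ^ η)) hne).trans
    (le_iSup₂ (f := fun y (_ : y ∈ E) => ⨆ _ : x ≠ y,
      ENNReal.ofReal (|u x - u y| / ρ x y ^ η)) y hy)).trans
    (le_iSup₂ (f := fun x (_ : x ∈ E) => ⨆ y ∈ E, ⨆ _ : x ≠ y,
      ENNReal.ofReal (|u x - u y| / ρ x y ^ η)) x hx))

lemma holderNorm_le {P Q : ℝ} (hP0 : 0 ≤ P) (hQ0 : 0 ≤ Q) (hP : ∀ x ∈ E, |u x| ≤ P)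
    (hQ : ∀ x ∈ E, ∀ y ∈ E, x ≠ y → 0 < ρ x y ∧ |u x - u y| ≤ Q * ρ x y ^ η) :
    holderNorm ρ η E u ≤ ENNReal.ofReal (P + Q) := by
  rw [ENNReal.ofReal_add hP0 hQ0]
  refine add_le_add (iSup₂_le fun x hx => ENNReal.ofReal_le_ofReal (hP x hx))
    (iSup₂_le fun x hx => iSup₂_le fun y hy => iSup_le fun hxy => ENNReal.ofReal_le_ofReal ?_)
  obtain ⟨h0, h1⟩ := hQ x hx y hy hxy
  rwa [div_le_iff₀ (Real.rpow_pos_of_pos h0 _)]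

end HolderNorm

/-- Working with lower integrals, domination yields absolute convergence and the bound together,
without measurability of `w`. -/
lemma integrable_and_abs_integral_le {Ω : Type*} [MeasurableSpace Ω] {μ : Measure Ω}
    {g w : Ω → ℝ} {c J : ℝ} (hg : AEStronglyMeasurable g μ) (hc : 0 ≤ c) (hJ : 0 ≤ J)
    (hw : ∫⁻ y, ENNReal.ofReal (w y) ∂μ ≤ ENNReal.ofReal J) (h : ∀ y, |g y| ≤ c * w y) :
    Integrable g μ ∧ |∫ y, g y ∂μ| ≤ c * J := by
  have hle : ∫⁻ y, ‖g y‖ₑ ∂μ ≤ ENNReal.ofReal (c * J) := by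
    calc ∫⁻ y, ‖g y‖ₑ ∂μ ≤ ∫⁻ y, ENNReal.ofReal c * ENNReal.ofReal (w y) ∂μ := by
          refine lintegral_mono fun y => ?_
          rw [Real.enorm_eq_ofReal_abs, ← ENNReal.ofReal_mul hc]
          exact ENNReal.ofReal_le_ofReal (h y)
      _ = ENNReal.ofReal c * ∫⁻ y, ENNReal.ofReal (w y) ∂μ :=
          lintegral_const_mul' _ _ ENNReal.ofReal_ne_top
      _ ≤ ENNReal.ofReal (c * J) := by
          rw [ENNReal.ofReal_mul hc]
          gcongr
  refine ⟨⟨hg, hle.trans_lt ENNReal.ofReal_lt_top⟩, ?_⟩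
  rw [← ENNReal.ofReal_le_ofReal_iff (mul_nonneg hc hJ), ← Real.enorm_eq_ofReal_abs]
  exact (enorm_integral_le_lintegral_enorm g).trans hle

/-! ### Weights and integrands extended by zero, and their measurability. -/

noncomputable section

/-- The weight `ρ(x, y)^s / μ(B(x, ρ(x, y)))` on `D \ {x}`, extended by zero. -/
def fracWeight {Ω : Type*} [MeasurableSpace Ω] (ρ : Ω → Ω → ℝ) (μ : Measure Ω) (s : ℝ)
    (D : Set Ω) (x : Ω) : Ω → ℝ :=
  (D \ {x}).indicator fun y => ρ x y ^ s / μ.real (rhoBall ρ x (ρ x y))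

/-- The integrand `k(x, ·) f` of `fracIntegral`, extended by zero. -/
def fracIntegrand {Ω : Type*} (D : Set Ω) (k : Ω → Ω → ℝ) (f : Ω → ℝ) (x : Ω) : Ω → ℝ :=
  (D \ {x}).indicator fun y => k x y * f y

end

namespace LocallyHomogeneousSpace

variable {Ω : Type*} [TopologicalSpace Ω] [MeasurableSpace Ω] {μ : Measure Ω}

lemma measurableSet_rhoBall (S : LocallyHomogeneousSpace Ω μ) (x : Ω) (r : ℝ) :
    MeasurableSet (rhoBall S.ρ x r) := by
  have := S.borel
  rcases le_or_gt r 0 with hr | hr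
  · convert MeasurableSet.empty
    exact Set.eq_empty_of_forall_notMem fun y hy => absurd (S.rho_nonneg x y)
      (not_le.2 (lt_of_lt_of_le hy hr))
  · exact (S.isOpen_ball x r hr).measurableSet

lemma measurable_rho (S : LocallyHomogeneousSpace Ω μ) (x : Ω) : Measurable (S.ρ x) :=
  measurable_of_Iio fun r => S.measurableSet_rhoBall x r

lemma measurableSet_diff_singleton (S : LocallyHomogeneousSpace Ω μ) {D : Set Ω}
    (hD : MeasurableSet D) (x : Ω) : MeasurableSet (D \ {x}) := by
  have := S.borel
  exact hD.diff (S.isClosed_singleton x).measurableSet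

lemma measurable_fracWeight (S : LocallyHomogeneousSpace Ω μ) {D : Set Ω}
    (hD : MeasurableSet D) (s : ℝ) (x : Ω) : Measurable (fracWeight S.ρ μ s D x) := by
  refine Measurable.indicator ?_ (S.measurableSet_diff_singleton hD x)
  -- The measure of a ball is monotone in its radius, hence a Borel function of it.
  have hmono : Monotone fun t => μ (rhoBall S.ρ x t) := fun t t' h =>
    measure_mono fun y hy => lt_of_lt_of_le hy h
  exact ((S.measurable_rho x).pow_const s).div
    (hmono.measurable.comp (S.measurable_rho x)).ennreal_toReal

lemma fracWeight_nonneg (S : LocallyHomogeneousSpace Ω μ) (s : ℝ) (D : Set Ω) (x y : Ω) :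
    0 ≤ fracWeight S.ρ μ s D x y :=
  Set.indicator_nonneg (fun y _ => div_nonneg (Real.rpow_nonneg (S.rho_nonneg x y) _)
    measureReal_nonneg) y

lemma lintegral_fracWeight_le (S : LocallyHomogeneousSpace Ω μ) {m : ℕ} {x : Ω}
    (hx : x ∈ S.exh m) {r s : ℝ} (hr0 : 0 < r) (hr : r ≤ 2 * S.eps m) (hs : 0 < s)
    {D : Set Ω} (hD : MeasurableSet D) (hDr : D ⊆ rhoBall S.ρ x r) :
    ∫⁻ y, ENNReal.ofReal (fracWeight S.ρ μ s D x y) ∂μ ≤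
      ENNReal.ofReal (S.dbl m * r ^ s * (1 - (1 / 2 : ℝ) ^ s)⁻¹) := by
  refine le_trans ?_ (S.lintegral_fractional_le hx hr0 hr hs)
  refine le_trans (le_of_eq ?_) (lintegral_mono_set (Set.sdiff_subset_sdiff_left hDr))
  rw [← lintegral_indicator (S.measurableSet_diff_singleton hD x)]
  refine lintegral_congr fun y => ?_
  by_cases hy : y ∈ D \ {x} <;> simp [fracWeight, hy]

/-! ### Pointwise estimates for the cut off kernel. -/

/-- The data of a cut off kernel of fractional type, restricted to a set `D` of diameter at most
`P`. -/
structure KernelSetting (S : LocallyHomogeneousSpace Ω μ) (m : ℕ) (D : Set Ω)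
    (ν β A B M α L R F : ℝ) (K : Ω → Ω → ℝ) (a b f : Ω → ℝ) : Prop where
  std : StandardEstimates S.ρ μ D ν β A B M K
  sub : D ⊆ S.exh m
  diam : ∀ x ∈ D, ∀ y ∈ D, S.ρ x y < 2 * S.quasi m * R
  abs_a : ∀ x ∈ D, |a x| ≤ 1
  abs_b : ∀ x ∈ D, |b x| ≤ 1
  abs_f : ∀ x ∈ D, |f x| ≤ F
  holder_a : ∀ x ∈ D, ∀ y ∈ D, |a x - a y| ≤ L * (S.ρ x y / R) ^ α

variable {S : LocallyHomogeneousSpace Ω μ} {m : ℕ} {D : Set Ω} {ν β A B M α L R F η : ℝ}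
  {K : Ω → Ω → ℝ} {a b f : Ω → ℝ}

/-- Of the `ν` powers of `ρ`, `η` are traded for the bound `P` and the rest stay in the weight.
Later `P` is a multiple of `ρ x₁ x₂` or the diameter bound. -/
lemma KernelSetting.size_weight (h : KernelSetting S m D ν β A B M α L R F K a b f)
    (hA : 0 ≤ A) (hη : 0 ≤ η) {P : ℝ} {x y : Ω} (hx : x ∈ D) (hy : y ∈ D) (hxy : x ≠ y)
    (hP : S.ρ x y ≤ P) : |K x y| ≤ A * P ^ η * fracWeight S.ρ μ (ν - η) D x y := by
  have hρ := S.rho_pos hxy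
  have hw : fracWeight S.ρ μ (ν - η) D x y =
      S.ρ x y ^ (ν - η) / μ.real (rhoBall S.ρ x (S.ρ x y)) :=
    Set.indicator_of_mem (show y ∈ D \ {x} from ⟨hy, fun h => hxy h.symm⟩) _
  have hsplit : S.ρ x y ^ ν = S.ρ x y ^ η * S.ρ x y ^ (ν - η) := by
    rw [← Real.rpow_add hρ]
    congr 1
    ring
  have hle : A * S.ρ x y ^ η ≤ A * P ^ η :=
    mul_le_mul_of_nonneg_left (Real.rpow_le_rpow hρ.le hP hη) hA
  refine (h.std.size x hx y hy hxy).trans (le_trans (le_of_eq ?_)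
    (mul_le_mul_of_nonneg_right hle (S.fracWeight_nonneg (ν - η) D x y)))
  rw [hw, hsplit]
  ring

lemma KernelSetting.abs_fracIntegrand_le
    (h : KernelSetting S m D ν β A B M α L R F K a b f)
    (hA : 0 ≤ A) (hη : 0 ≤ η) (hF : 0 ≤ F) {P : ℝ} {x y : Ω} (hx : x ∈ D) (hP0 : 0 ≤ P)
    (hP : y ∈ D → S.ρ x y ≤ P) :
    |fracIntegrand D (cutoffKernel a K b) f x y| ≤
      A * P ^ η * F * fracWeight S.ρ μ (ν - η) D x y := by
  have hw0 := S.fracWeight_nonneg (μ := μ) (ν - η) D x y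
  by_cases hy : y ∈ D \ {x}
  · rw [fracIntegrand, Set.indicator_of_mem hy, cutoffKernel, abs_mul, abs_mul, abs_mul]
    have hK := h.size_weight hA hη hx hy.1 (fun h => hy.2 h.symm) (hP hy.1)
    calc |a x| * |K x y| * |b y| * |f y|
        ≤ 1 * (A * P ^ η * fracWeight S.ρ μ (ν - η) D x y) * 1 * F := by
          gcongr
          exacts [h.abs_a x hx, h.abs_b y hy.1, h.abs_f y hy.1]
      _ = _ := by ring
  · rw [fracIntegrand, Set.indicator_of_notMem hy, abs_zero]
    positivity

/-- The four constants come from the region near `x₁` (one for each integrand), the variation of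
`a`, and the smoothness of `K`. -/
lemma KernelSetting.abs_fracIntegrand_sub_le
    (h : KernelSetting S m D ν β A B M α L R F K a b f)
    (hA : 0 ≤ A) (hB : 0 ≤ B) (hL : 0 ≤ L) (hM : 1 < M) (hR : 0 < R) (hF : 0 ≤ F) (hη : 0 < η)
    (hηα : η ≤ α) (hηβ : η ≤ β) {x₁ x₂ : Ω} (hx₁ : x₁ ∈ D) (hx₂ : x₂ ∈ D) (hne : x₁ ≠ x₂)
    (y : Ω) :
    |fracIntegrand D (cutoffKernel a K b) f x₁ y - fracIntegrand D (cutoffKernel a K b) f x₂ y| ≤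
      (A * M ^ η + A * (S.quasi m * (1 + M)) ^ η +
        L * A * ((2 * S.quasi m) ^ (α - η) * (2 * S.quasi m) ^ η) + B) * F * S.ρ x₁ x₂ ^ η *
      (fracWeight S.ρ μ (ν - η) D x₁ y + fracWeight S.ρ μ (ν - η) D x₂ y) := by
  set q := S.quasi m with hq
  set δ := S.ρ x₁ x₂ with hδ
  set w₁ := fracWeight S.ρ μ (ν - η) D x₁ y with hw₁
  set w₂ := fracWeight S.ρ μ (ν - η) D x₂ y with hw₂
  have hw₁0 : 0 ≤ w₁ := S.fracWeight_nonneg (ν - η) D x₁ y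
  have hw₂0 : 0 ≤ w₂ := S.fracWeight_nonneg (ν - η) D x₂ y
  have hq1 : 1 ≤ q := S.one_le_quasi m
  have hδ0 : 0 < δ := S.rho_pos hne
  have hM0 : 0 < M := one_pos.trans hM
  have hq0 : 0 < q := one_pos.trans_le hq1
  set X₁ := A * M ^ η with hX₁
  set X₂ := A * (q * (1 + M)) ^ η with hX₂
  set X₃ := L * A * ((2 * q) ^ (α - η) * (2 * q) ^ η) with hX₃
  have hX₁0 : 0 ≤ X₁ := by positivity
  have hX₂0 : 0 ≤ X₂ := by positivity
  have hX₃0 : 0 ≤ X₃ := by positivity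
  have hFd : 0 ≤ F * δ ^ η := by positivity
  by_cases hy : y ∈ D
  swap
  · have h₁ : y ∉ D \ {x₁} := fun h => hy h.1
    have h₂ : y ∉ D \ {x₂} := fun h => hy h.1
    rw [fracIntegrand, fracIntegrand, Set.indicator_of_notMem h₁, Set.indicator_of_notMem h₂,
      sub_self, abs_zero]
    positivity
  rcases le_or_gt (S.ρ x₁ y) (M * δ) with hnear | hfar
  · have h₂ : S.ρ x₂ y ≤ q * (1 + M) * δ := by
      have := S.quasi_triangle m x₂ (h.sub hx₂) y (h.sub hy) x₁ (h.sub hx₁)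
      rw [S.rho_symm x₂ x₁] at this
      refine this.trans ?_
      rw [mul_assoc]
      gcongr
      change δ + _ ≤ _
      linarith
    have e₁ := h.abs_fracIntegrand_le hA hη.le hF hx₁ (by positivity) fun _ => hnear
    have e₂ := h.abs_fracIntegrand_le hA hη.le hF hx₂ (by positivity) fun _ => h₂
    rw [Real.mul_rpow hM0.le hδ0.le] at e₁
    rw [Real.mul_rpow (by positivity) hδ0.le] at e₂
    calc _ ≤ _ := abs_sub _ _
      _ ≤ X₁ * (F * δ ^ η) * w₁ + X₂ * (F * δ ^ η) * w₂ := by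
          refine (add_le_add e₁ e₂).trans (le_of_eq ?_)
          simp only [hX₁, hX₂]
          ring
      _ ≤ (X₁ + X₂ + X₃ + B) * (F * δ ^ η) * w₁ + (X₁ + X₂ + X₃ + B) * (F * δ ^ η) * w₂ := by
          gcongr <;> linarith
      _ = _ := by ring
  · have hδlt : δ < S.ρ x₁ y := lt_of_le_of_lt (le_mul_of_one_le_left hδ0.le hM.le) hfar
    have hρ0 : 0 < S.ρ x₁ y := hδ0.trans hδlt
    have hyx₁ : x₁ ≠ y := by
      rintro rfl
      rw [S.rho_self] at hρ0
      exact lt_irrefl _ hρ0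
    have hyx₂ : x₂ ≠ y := by
      rintro rfl
      exact lt_irrefl _ hδlt
    -- The exponent drops from `α` to `η` because `δ / R` is at most `2 * q`.
    have hdiff : |a x₁ - a x₂| ≤ L * ((2 * q) ^ (α - η) * (δ / R) ^ η) := by
      refine (h.holder_a x₁ hx₁ x₂ hx₂).trans ?_
      have hdR : 0 < δ / R := by positivity
      have : (δ / R) ^ α = (δ / R) ^ (α - η) * (δ / R) ^ η := by
        rw [← Real.rpow_add hdR, sub_add_cancel]
      change L * (δ / R) ^ α ≤ _
      rw [this]
      gcongr
      exact (div_le_iff₀ hR).2 (h.diam x₁ hx₁ x₂ hx₂).le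
    have hK₁ := h.size_weight hA hη.le hx₁ hy hyx₁ (h.diam x₁ hx₁ y hy).le
    have hK₁₂ : |K x₁ y - K x₂ y| ≤ B * δ ^ η * w₁ := by
      refine (le_add_of_nonneg_right (abs_nonneg _)).trans
        ((h.std.smooth x₁ hx₁ x₂ hx₂ y hy hfar).trans ?_)
      have hw : w₁ = S.ρ x₁ y ^ (ν - η) / μ.real (rhoBall S.ρ x₁ (S.ρ x₁ y)) :=
        Set.indicator_of_mem (show y ∈ D \ {x₁} from ⟨hy, fun h => hyx₁ h.symm⟩) _
      -- The ratio is below `1` in the far region, so `β` may be lowered to `η`.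
      have h1 : (δ / S.ρ x₁ y) ^ β ≤ (δ / S.ρ x₁ y) ^ η :=
        Real.rpow_le_rpow_of_exponent_ge (by positivity) ((div_le_one hρ0).2 hδlt.le) hηβ
      refine (mul_le_mul_of_nonneg_left h1 (by positivity)).trans (le_of_eq ?_)
      rw [hw, Real.div_rpow hδ0.le hρ0.le, Real.rpow_sub hρ0]
      ring
    have hm₁ : y ∈ D \ {x₁} := ⟨hy, fun h => hyx₁ h.symm⟩
    have hm₂ : y ∈ D \ {x₂} := ⟨hy, fun h => hyx₂ h.symm⟩
    rw [fracIntegrand, fracIntegrand, Set.indicator_of_mem hm₁, Set.indicator_of_mem hm₂]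
    have hid : cutoffKernel a K b x₁ y * f y - cutoffKernel a K b x₂ y * f y =
        ((a x₁ - a x₂) * K x₁ y + a x₂ * (K x₁ y - K x₂ y)) * b y * f y := by
      simp only [cutoffKernel]
      ring
    rw [hid, abs_mul, abs_mul]
    have hsum : |(a x₁ - a x₂) * K x₁ y + a x₂ * (K x₁ y - K x₂ y)| ≤
        L * ((2 * q) ^ (α - η) * (δ / R) ^ η) * (A * (2 * q * R) ^ η * w₁) +
          1 * (B * δ ^ η * w₁) := by
      refine (abs_add_le _ _).trans ?_
      rw [abs_mul, abs_mul]
      exact add_le_add (mul_le_mul hdiff hK₁ (abs_nonneg _) (by positivity))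
        (mul_le_mul (h.abs_a x₂ hx₂) hK₁₂ (abs_nonneg _) zero_le_one)
    have hRη : R ^ η ≠ 0 := (Real.rpow_pos_of_pos hR η).ne'
    calc _ ≤ (L * ((2 * q) ^ (α - η) * (δ / R) ^ η) * (A * (2 * q * R) ^ η * w₁) +
          1 * (B * δ ^ η * w₁)) * 1 * F := by
          gcongr
          exacts [h.abs_b y hy, h.abs_f y hy]
      -- The factor `R ^ η` from the size bound cancels the one in `(δ / R) ^ η`.
      _ = (X₃ + B) * (F * δ ^ η) * w₁ := by
          rw [Real.div_rpow hδ0.le hR.le, Real.mul_rpow (by positivity : 0 ≤ 2 * q) hR.le, hX₃]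
          field_simp
      _ ≤ (X₁ + X₂ + X₃ + B) * (F * δ ^ η) * (w₁ + w₂) := by
          gcongr <;> linarith
      _ = _ := by ring

/-- For fixed `x`, joint measurability of `k` passes to its slice and `a x` is a constant. -/
lemma aestronglyMeasurable_fracIntegrand {E D : Set Ω} {k : Ω → Ω → ℝ} {f a b : Ω → ℝ}
    (S : LocallyHomogeneousSpace Ω μ) (hD : MeasurableSet D) (hDE : D ⊆ E)
    (hk : Measurable (fun p : {p : Ω × Ω // p.1 ∈ E ∧ p.2 ∈ E ∧ p.1 ≠ p.2} => k p.1.1 p.1.2))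
    (hb : ContinuousOn b D) (hf : ContinuousOn f D) {x : Ω} (hx : x ∈ D) :
    AEStronglyMeasurable (fracIntegrand D (cutoffKernel a k b) f x) μ := by
  have := S.borel
  have hDx := S.measurableSet_diff_singleton hD x
  refine (aestronglyMeasurable_indicator_iff hDx).2 ?_
  have hkx : AEStronglyMeasurable (k x) (μ.restrict (D \ {x})) := by
    refine (aemeasurable_restrict_of_measurable_subtype hDx ?_).aestronglyMeasurable
    exact hk.comp (g := fun p : {p : Ω × Ω // p.1 ∈ E ∧ p.2 ∈ E ∧ p.1 ≠ p.2} => k p.1.1 p.1.2)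
      (f := fun y : ↥(D \ {x}) =>
        ⟨(x, y.1), hDE hx, hDE y.2.1, fun h => y.2.2 h.symm⟩)
      (Measurable.subtype_mk (measurable_const.prodMk measurable_subtype_coe))
  have hbx := (hb.mono (Set.sdiff_subset (t := {x}))).aestronglyMeasurable (μ := μ) hDx
  have hfx := (hf.mono (Set.sdiff_subset (t := {x}))).aestronglyMeasurable (μ := μ) hDx
  exact ((hkx.const_mul (a x)).mul hbx).mul hfx

end LocallyHomogeneousSpace

/-! ### Integration of the pointwise estimates. -/

namespace LocallyHomogeneousSpace

variable {Ω : Type*} [TopologicalSpace Ω] [MeasurableSpace Ω] {μ : Measure Ω}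
  {S : LocallyHomogeneousSpace Ω μ} {m : ℕ} {D : Set Ω} {ν β A B M α L R F η : ℝ}
  {K : Ω → Ω → ℝ} {a b f : Ω → ℝ}

/-- Boundedness of `f` on `D` gives integrability and a Hölder bound for its fractional
integral. -/
lemma KernelSetting.integrableOn_and_holderNorm_le
    (h : KernelSetting S m D ν β A B M α L R F K a b f)
    (hA : 0 ≤ A) (hB : 0 ≤ B) (hL : 0 ≤ L) (hM : 1 < M) (hR : 0 < R) (hF : 0 ≤ F) (hη : 0 < η)
    (hηα : η ≤ α) (hηβ : η ≤ β) (hην : η < ν) (hD : MeasurableSet D)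
    (hRm : S.quasi m * R ≤ S.eps m)
    (hmeas : ∀ x ∈ D, AEStronglyMeasurable (fracIntegrand D (cutoffKernel a K b) f x) μ)
    {J C : ℝ} (hJ : J = S.dbl m * (2 * S.quasi m * R) ^ (ν - η) *
      (1 - (1 / 2 : ℝ) ^ (ν - η))⁻¹)
    (hC : C = A * M ^ η + A * (S.quasi m * (1 + M)) ^ η +
        L * A * ((2 * S.quasi m) ^ (α - η) * (2 * S.quasi m) ^ η) + B) :
    (∀ x ∈ D, IntegrableOn (fun y => cutoffKernel a K b x y * f y) (D \ {x}) μ) ∧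
      holderNorm S.ρ η D (fracIntegral μ D (cutoffKernel a K b) f) ≤
        ENNReal.ofReal ((A * (2 * S.quasi m * R) ^ η * J + C * (J + J)) * F) := by
  have hq0 : 0 < S.quasi m := one_pos.trans_le (S.one_le_quasi m)
  have hM0 : 0 < M := one_pos.trans hM
  have hd0 : 0 < S.dbl m := one_pos.trans (S.one_lt_dbl m)
  have hs : 0 < ν - η := sub_pos.2 hην
  have hJ0 : 0 ≤ J := by
    have : (1 / 2 : ℝ) ^ (ν - η) < 1 := Real.rpow_lt_one (by norm_num) (by norm_num) hs
    have : 0 ≤ (1 - (1 / 2 : ℝ) ^ (ν - η))⁻¹ := inv_nonneg.2 (sub_nonneg.2 this.le)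
    rw [hJ]
    positivity
  have hC0 : 0 ≤ C := by
    rw [hC]
    positivity
  have hweight : ∀ x ∈ D,
      ∫⁻ y, ENNReal.ofReal (fracWeight S.ρ μ (ν - η) D x y) ∂μ ≤ ENNReal.ofReal J := by
    intro x hx
    rw [hJ]
    exact S.lintegral_fracWeight_le (h.sub hx) (by positivity) (by linarith) hs hD
      fun y hy => h.diam x hx y hy
  have hone : ∀ x ∈ D, Integrable (fracIntegrand D (cutoffKernel a K b) f x) μ ∧
      |∫ y, fracIntegrand D (cutoffKernel a K b) f x y ∂μ| ≤
        A * (2 * S.quasi m * R) ^ η * F * J := fun x hx =>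
    integrable_and_abs_integral_le (hmeas x hx) (by positivity) hJ0 (hweight x hx) fun y =>
      h.abs_fracIntegrand_le hA hη.le hF hx (by positivity) fun hy => (h.diam x hx y hy).le
  -- The integrals for `x₁` and `x₂` run over different punctured sets; after extension by zero they
  -- can be subtracted.
  have hI : ∀ x, fracIntegral μ D (cutoffKernel a K b) f x =
      ∫ y, fracIntegrand D (cutoffKernel a K b) f x y ∂μ := fun x =>
    (integral_indicator (S.measurableSet_diff_singleton hD x)).symm
  refine ⟨fun x hx =>
    (integrable_indicator_iff (S.measurableSet_diff_singleton hD x)).1 (hone x hx).1, ?_⟩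
  have hP : A * (2 * S.quasi m * R) ^ η * F * J + C * F * (J + J) =
      (A * (2 * S.quasi m * R) ^ η * J + C * (J + J)) * F := by ring
  rw [← hP]
  refine holderNorm_le (by positivity) (by positivity) (fun x hx => ?_)
    fun x₁ hx₁ x₂ hx₂ hne => ⟨S.rho_pos hne, ?_⟩
  · rw [hI]
    exact (hone x hx).2
  · have hw : ∫⁻ y, ENNReal.ofReal (fracWeight S.ρ μ (ν - η) D x₁ y +
        fracWeight S.ρ μ (ν - η) D x₂ y) ∂μ ≤ ENNReal.ofReal (J + J) := by
      simp_rw [ENNReal.ofReal_add (S.fracWeight_nonneg (μ := μ) (ν - η) D x₁ _)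
        (S.fracWeight_nonneg (μ := μ) (ν - η) D x₂ _)]
      rw [lintegral_add_left (S.measurable_fracWeight hD _ _).ennreal_ofReal,
        ENNReal.ofReal_add hJ0 hJ0]
      exact add_le_add (hweight x₁ hx₁) (hweight x₂ hx₂)
    have hρ : 0 ≤ S.ρ x₁ x₂ ^ η := Real.rpow_nonneg (S.rho_nonneg _ _) _
    rw [hI, hI, ← integral_sub (hone x₁ hx₁).1 (hone x₂ hx₂).1]
    refine (integrable_and_abs_integral_le (c := C * F * S.ρ x₁ x₂ ^ η)
      ((hmeas x₁ hx₁).sub (hmeas x₂ hx₂)) (by positivity) (add_nonneg hJ0 hJ0) hw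
      fun y => ?_).2.trans (le_of_eq (by ring))
    rw [hC]
    exact h.abs_fracIntegrand_sub_le hA hB hL hM hR hF hη hηα hηβ hx₁ hx₂ hne y

end LocallyHomogeneousSpace

/-! ### Choice of constants and conclusion. -/

/-- `e i, q i, d i` are the constants `ε, B, C` of `Ω_{n+i}`, `i = 0, 1, 2, 3`. The numbers `κ`, `H`
depend only on these; `c` depends only on these, on `R`, and on the exponents and constants of
the kernel and of the cutoff functions. -/
theorem mainTheorem9 (e q d : Fin 4 → ℝ) :
    ∃ κ H : ℝ, 1 < κ ∧ 1 < H ∧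
      ∀ ν β A B M α L c₁ c₂ c₃ c₄ η R : ℝ,
        0 < ν → ν < 1 → 0 < β → 0 < A → 0 < B → 1 < M → 2 * q 1 ≤ M →
        0 < α → 0 < L →
        c₁ ∈ Set.Ioo (0 : ℝ) 1 → c₂ ∈ Set.Ioo (0 : ℝ) 1 →
        c₃ ∈ Set.Ioo (0 : ℝ) 1 → c₄ ∈ Set.Ioo (0 : ℝ) 1 →
        0 < η → η < min α (min β ν) → 0 < R →
        ∃ c : ℝ, 0 < c ∧
          ∀ (Ω : Type*) [TopologicalSpace Ω] [MeasurableSpace Ω] (μ : Measure Ω)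
            (S : LocallyHomogeneousSpace Ω μ) (n : ℕ),
            (∀ i : Fin 4, S.eps (n + i) = e i ∧ S.quasi (n + i) = q i ∧ S.dbl (n + i) = d i) →
            ∀ xbar ∈ S.exh n, ∀ R₀ : ℝ, R₀ < 2 * S.eps n → κ * R ≤ R₀ →
            ∀ (K : Ω → Ω → ℝ) (a b : Ω → ℝ),
              Measurable (fun p : {p : Ω × Ω // p.1 ∈ rhoBall S.ρ xbar R₀ ∧
                p.2 ∈ rhoBall S.ρ xbar R₀ ∧ p.1 ≠ p.2} => K p.1.1 p.1.2) →
              StandardEstimates S.ρ μ (rhoBall S.ρ xbar R₀) ν β A B M K →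
              IsHolderCutoff S.ρ (S.exh (n + 1)) α L xbar c₁ c₂ R a →
              IsHolderCutoff S.ρ (S.exh (n + 1)) α L xbar c₃ c₄ R b →
              ∀ f : Ω → ℝ, holderNorm S.ρ η (rhoBall S.ρ xbar (H * R)) f < ∞ →
                (∀ x ∈ rhoBall S.ρ xbar R,
                  IntegrableOn (fun y => cutoffKernel a K b x y * f y)
                    (rhoBall S.ρ xbar R \ {x}) μ) ∧
                holderNorm S.ρ η (rhoBall S.ρ xbar R)
                    (fracIntegral μ (rhoBall S.ρ xbar R) (cutoffKernel a K b) f) ≤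
                  ENNReal.ofReal c * holderNorm S.ρ η (rhoBall S.ρ xbar (H * R)) f := by
  -- The entry `2` gives `2 * R ≤ R₀`. The other, with `R₀ < 2 * e 0`, gives `q 1 * R ≤ e 1`, so the
  -- diameter bound `2 * q 1 * R` stays within the doubling range of `Ω_{n+1}`.
  refine ⟨max 2 (2 * q 1 * e 0 / e 1), 2, lt_max_of_lt_left one_lt_two, one_lt_two, ?_⟩
  intro ν β A B M α L c₁ c₂ c₃ c₄ η R _ _ _ hA hB hM _ hα hL _ _ _ _ hη hηlt hR
  obtain ⟨hηα, hηβ, hην⟩ : η < α ∧ η < β ∧ η < ν := by simpa [lt_min_iff] using hηlt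
  set J := d 1 * (2 * q 1 * R) ^ (ν - η) * (1 - (1 / 2 : ℝ) ^ (ν - η))⁻¹ with hJ
  set C := A * M ^ η + A * (q 1 * (1 + M)) ^ η +
    L * A * ((2 * q 1) ^ (α - η) * (2 * q 1) ^ η) + B with hC
  -- The maximum with `1` only secures `0 < c`.
  refine ⟨max 1 (A * (2 * q 1 * R) ^ η * J + C * (J + J)), lt_max_of_lt_left one_pos, ?_⟩
  intro Ω _ _ μ S n hS xbar hxbar R₀ hR₀ hκ K a b hKm hK ha hb f hf
  have he0 : S.eps n = e 0 := (hS 0).1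
  obtain ⟨he1, hq1, hd1⟩ : S.eps (n + 1) = e 1 ∧ S.quasi (n + 1) = q 1 ∧ S.dbl (n + 1) = d 1 :=
    hS 1
  have he1pos : 0 < e 1 := he1 ▸ S.eps_pos (n + 1)
  have hq1one : 1 ≤ q 1 := hq1 ▸ S.one_le_quasi (n + 1)
  have hRR₀ : 2 * R ≤ R₀ := (mul_le_mul_of_nonneg_right (le_max_left _ _) hR.le).trans hκ
  have hqR : q 1 * R ≤ e 1 := by
    have h1 : 2 * q 1 * e 0 / e 1 * R ≤ R₀ :=
      (mul_le_mul_of_nonneg_right (le_max_right _ _) hR.le).trans hκ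
    have he0pos : 0 < e 0 := he0 ▸ S.eps_pos n
    rw [he0] at hR₀
    have h2 : 2 * q 1 * e 0 / e 1 * R = q 1 * R / e 1 * (2 * e 0) := by ring
    have h3 : q 1 * R / e 1 * (2 * e 0) ≤ 1 * (2 * e 0) := by linarith
    exact (div_le_one he1pos).1 (le_of_mul_le_mul_right h3 (by positivity))
  set D := rhoBall S.ρ xbar R
  have hDE : D ⊆ rhoBall S.ρ xbar R₀ := fun y hy =>
    lt_of_lt_of_le (b := R) hy (by linarith)
  have hDH : D ⊆ rhoBall S.ρ xbar (2 * R) := fun y hy =>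
    lt_of_lt_of_le (b := R) hy (by linarith)
  have hDexh : D ⊆ S.exh (n + 1) := hDE.trans (S.rhoBall_subset_exh hxbar hR₀.le)
  have hD : MeasurableSet D := S.measurableSet_rhoBall xbar R
  set F := (holderNorm S.ρ η (rhoBall S.ρ xbar (2 * R)) f).toReal
  have hfc : ContinuousOn f D := S.continuousOn_of_holder hη fun x hx y hy =>
    abs_sub_le_toReal_holderNorm hf (hDH hx) (hDH hy) (S.rho_nonneg x y) fun h => S.rho_pos h
  have hbc : ContinuousOn b D := by
    refine S.continuousOn_of_holder (C := L / R ^ α) hα fun x hx y hy =>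
      (hb.holder x (hDexh hx) y (hDexh hy)).trans (le_of_eq ?_)
    rw [Real.div_rpow (S.rho_nonneg x y) hR.le]
    ring
  have hset : S.KernelSetting (n + 1) D ν β A B M α L R F K a b f :=
    { std := ⟨fun x hx y hy => hK.size x (hDE hx) y (hDE hy),
        fun x₀ hx₀ x hx y hy => hK.smooth x₀ (hDE hx₀) x (hDE hx) y (hDE hy)⟩
      sub := hDexh
      diam := fun x hx y hy => by
        have h1 := S.quasi_triangle (n + 1) x (hDexh hx) y (hDexh hy) xbar
          (S.exh_mono n.le_succ hxbar)
        rw [S.rho_symm x xbar, hq1] at h1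
        have h2 : S.ρ xbar x < R := hx
        have h3 : S.ρ xbar y < R := hy
        rw [hq1]
        nlinarith
      abs_a := fun x hx => by
        obtain ⟨h0, h1⟩ := ha.mem_Icc x (hDexh hx)
        rwa [abs_of_nonneg h0]
      abs_b := fun x hx => by
        obtain ⟨h0, h1⟩ := hb.mem_Icc x (hDexh hx)
        rwa [abs_of_nonneg h0]
      abs_f := fun x hx => abs_le_toReal_holderNorm hf (hDH hx)
      holder_a := fun x hx y hy => ha.holder x (hDexh hx) y (hDexh hy) }
  obtain ⟨hint, hnorm⟩ := hset.integrableOn_and_holderNorm_le hA.le hB.le hL.le hM hR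
    ENNReal.toReal_nonneg hη hηα.le hηβ.le hην hD (by rwa [hq1, he1])
    (fun x hx => S.aestronglyMeasurable_fracIntegrand hD hDE hKm hbc hfc hx)
    (J := J) (C := C) (by rw [hJ, hd1, hq1]) (by rw [hC, hq1])
  refine ⟨hint, hnorm.trans ?_⟩
  rw [hq1, ← ENNReal.ofReal_toReal hf.ne, ← ENNReal.ofReal_mul (by positivity)]
  exact ENNReal.ofReal_le_ofReal
    (mul_le_mul_of_nonneg_right (le_max_right _ _) ENNReal.toReal_nonneg)
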